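/- Let $X, X_1, X_2, \ldots$ be i.i.d. real random variables, let $S_n := \sum_{i=1}^n X_i$, and let $G_n := \frac1n \sum_{i=1}^n S_i$ for $n \ge 1$ (with $G_0 := 0$). Suppose that - $X$ is lattice with maximal span $h$: there are $b \in \mathbb{R}$ and $h > 0$ with $\Pr(X \in b + h\mathbb{Z}) = 1$, and $h' \le h$ whenever $h' > 0$ and $\Pr(X \in b' + h'\mathbb{Z}) = 1$ for some $b' \in \mathbb{R}$; - $X$ is symmetric: $X \stackrel{d}{=} -X$; - $X$ is in the domain of normal attraction of a (non-degenerate) symmetric $\alpha$-stable law $\nu$ for some $\alpha \in (0,1)$: there are a constant $a > 0$ and reals $A_n$ such that $\frac{S_n}{a\, n^{1/\alpha}} - A_n$ converges in distribution to $\nu$ as $n \to \infty$. Here a non-degenerate law $\nu$ on $\mathbb{R}$ is $\alpha$-stable if, for $Y, Y_1, Y_2$ independent with law $\nu$ and every $r, s > 0$, there is $D \in \mathbb{R}$ such that $r Y_1 + s Y_2 \stackrel{d}{=} (r^\alpha + s^\alpha)^{1/\alpha} Y + D$; it is symmetric if $Y \stackrel{d}{=} -Y$. Then, almost surely, $$\liminf_{n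 \to \infty} G_n = -\infty, \qquad \limsup_{n \to \infty} G_n = +\infty, \qquad \text{and} \qquad \lim_{n \to \infty} |G_n| = \infty .$$ -/

import Mathlib

open MeasureTheory ProbabilityTheory Filter Topology

/-- The random walk `S n = X 0 + ⋯ + X (n - 1)`; the `i`-th increment is `X (i - 1)`. -/
def walk {Ω : Type*} (X : ℕ → Ω → ℝ) (n : ℕ) (ω : Ω) : ℝ :=
  ∑ i ∈ Finset.range n, X i ω

/-- The centre of mass `G n = (1 / n) * (S 1 + ⋯ + S n)`, with `G 0 = 0`. -/
noncomputable def centreOfMass {Ω : Type*} (X : ℕ → Ω → ℝ) (n : ℕ) (ω : Ω) : ℝ :=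
  (1 / (n : ℝ)) * ∑ i ∈ Finset.Icc 1 n, walk X i ω

/-- The probability law `μ` is carried by the lattice `b + h ℤ`. -/
def CarriedByLattice (μ : Measure ℝ) (b h : ℝ) : Prop :=
  ∀ᵐ x ∂μ, ∃ k : ℤ, x = b + h * (k : ℝ)

/-- `μ` is carried by `b + h ℤ`, where `h > 0` is maximal: whenever `μ` is carried by some
`b' + h' ℤ` with `h' > 0`, we have `h' ≤ h`. -/
def IsLatticeWithMaximalSpan (μ : Measure ℝ) (b h : ℝ) : Prop :=
  0 < h ∧ CarriedByLattice μ b h ∧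
    ∀ b' h' : ℝ, 0 < h' → CarriedByLattice μ b' h' → h' ≤ h

/-- A law `ν` on `ℝ` is symmetric if `Y` and `-Y` have the same law when `Y` has law `ν`. -/
def IsSymmetricLaw (ν : Measure ℝ) : Prop :=
  ν.map (fun x => -x) = ν

/-- `ν` is a (non-degenerate) stable law of index `α`: if `Y, Y₁, Y₂` are independent with law `ν`,
then for all `r, s > 0` there is a constant `D` such that `r Y₁ + s Y₂` has the same law as
`(r ^ α + s ^ α) ^ (1 / α) Y + D`. -/
def IsStableLaw (α : ℝ) (ν : Measure ℝ) : Prop :=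
  (∀ x : ℝ, ν ≠ Measure.dirac x) ∧
    ∀ r s : ℝ, 0 < r → 0 < s → ∃ D : ℝ,
      (ν.prod ν).map (fun y : ℝ × ℝ => r * y.1 + s * y.2) =
        ν.map (fun y : ℝ => (r ^ α + s ^ α) ^ (1 / α) * y + D)

/-- The i.i.d. increments `X 0, X 1, …` are in the domain of normal attraction of the `α`-stable
law `ν`: for some `a > 0` and some centring constants `A n`, the variables
`S n / (a * n ^ (1 / α)) - A n` converge in distribution to `ν`. -/
def InDomainOfNormalAttraction {Ω : Type*} [MeasurableSpace Ω] (P : Measure Ω)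
    [IsProbabilityMeasure P] (X : ℕ → Ω → ℝ) (α : ℝ) (ν : Measure ℝ)
    [IsProbabilityMeasure ν] : Prop :=
  ∃ a : ℝ, 0 < a ∧ ∃ A : ℕ → ℝ,
    TendstoInDistribution
      (fun (n : ℕ) (ω : Ω) => walk X n ω / (a * (n : ℝ) ^ (1 / α)) - A n)
      atTop (fun y : ℝ => y) (fun _ => P) ν

/-! The centre of mass G_n is a sum of independent increments with weights in (0, 1] of total at
least n / 2, so its characteristic function is a product of values of the characteristic function φ
of one increment. Normal attraction to a non-degenerate law forces |φ(s)| ≤ exp(-c s^α) for small s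
> 0 (`exists_norm_charFun_le_exp_neg_rpow`), hence a bound exp(-c n t^α / 2) for G_n at small t > 0.
Integrated through a small ball inequality, this gives P(|G_n| ≤ K) = O(n^(-1/α)) for each K
(`exists_measureReal_abs_centreOfMass_le`). As α < 1 this is summable, and Borel–Cantelli yields
|G_n| → ∞.

The event limsup G_n = +∞ is a tail event, so it has probability 0 or 1, and by symmetry liminf G_n
= -∞ has the same probability. Since |G_n| → ∞ forces at least one of them, both are almost sure
(`ae_unbounded_of_ae_tendsto_abs`). -/

/-! ### Small ball inequality -/

lemma integral_one_sub_mul_cos {y : ℝ} (hy : y ≠ 0) :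
    ∫ t in (0 : ℝ)..1, (1 - t) * Real.cos (t * y) = (1 - Real.cos y) / y ^ 2 := by
  have hderiv : ∀ t ∈ Set.uIcc (0 : ℝ) 1, HasDerivAt
      (fun t : ℝ => (1 - t) * (Real.sin (t * y) / y) - Real.cos (t * y) / y ^ 2)
      ((1 - t) * Real.cos (t * y)) t := by
    intro t _
    have hlin : HasDerivAt (fun t : ℝ => t * y) y t := by
      simpa using (hasDerivAt_id t).mul_const y
    have h := (((hasDerivAt_id t).const_sub 1).mul (hlin.sin.div_const y)).sub
      (hlin.cos.div_const (y ^ 2))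
    refine h.congr_deriv ?_
    simp only [id]
    field_simp
    ring
  rw [intervalIntegral.integral_eq_sub_of_hasDerivAt hderiv
    (Continuous.intervalIntegrable (by fun_prop) _ _)]
  simp
  field_simp
  ring

/-- The triangular weight is chosen for this positivity: points outside [-1, 1] can be discarded
when the kernel is averaged over a law. -/
lemma integral_one_sub_mul_cos_nonneg (y : ℝ) :
    0 ≤ ∫ t in (0 : ℝ)..1, (1 - t) * Real.cos (t * y) := by
  rcases eq_or_ne y 0 with rfl | hy
  · simp only [mul_zero, Real.cos_zero, mul_one]
    exact intervalIntegral.integral_nonneg zero_le_one fun t ht => by linarith [ht.2]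
  · rw [integral_one_sub_mul_cos hy]
    exact div_nonneg (by linarith [Real.cos_le_one y]) (sq_nonneg y)

lemma one_fifth_le_integral_one_sub_mul_cos {y : ℝ} (hy1 : |y| ≤ 1) :
    1 / 5 ≤ ∫ t in (0 : ℝ)..1, (1 - t) * Real.cos (t * y) := by
  rcases eq_or_ne y 0 with rfl | hy
  · simp only [mul_zero, Real.cos_zero, mul_one]
    rw [intervalIntegral.integral_sub (by simp) (by simp)]
    norm_num [integral_id]
  · rw [integral_one_sub_mul_cos hy, le_div_iff₀ (by positivity)]
    -- The bound cos y ≤ 1 - 2 y² / π² applies, and 2 / π² ≈ 0.2026 just exceeds 1 / 5.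
    have hcos := Real.cos_le_one_sub_mul_cos_sq (hy1.trans (by linarith [Real.pi_gt_three]))
    have hpi : (1 / 5 : ℝ) ≤ 2 / Real.pi ^ 2 := by
      rw [div_le_div_iff₀ (by norm_num) (by positivity)]
      nlinarith [Real.pi_lt_d2, Real.pi_pos]
    nlinarith [mul_le_mul_of_nonneg_right hpi (sq_nonneg y)]

/-- A small ball inequality: the mass near the origin is controlled by the characteristic function
on the unit interval. -/
lemma measureReal_abs_le_one_le_integral_norm_charFun (μ : Measure ℝ) [IsProbabilityMeasure μ] :
    μ.real {y | |y| ≤ 1} ≤ 5 * ∫ t in (0 : ℝ)..1, ‖charFun μ t‖ := by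
  have hmeas : MeasurableSet {y : ℝ | |y| ≤ 1} := measurableSet_le (by fun_prop) (by fun_prop)
  have hfin : IsFiniteMeasure (volume.restrict (Set.uIoc (0 : ℝ) 1)) := by
    rw [Set.uIoc_of_le zero_le_one]
    infer_instance
  have hintegrable : Integrable (Function.uncurry fun t y : ℝ => (1 - t) * Real.cos (t * y))
      ((volume.restrict (Set.uIoc (0 : ℝ) 1)).prod μ) := by
    refine Integrable.of_bound (C := 1) (by fun_prop) ?_
    have hset : ∀ᵐ p ∂((volume.restrict (Set.uIoc (0 : ℝ) 1)).prod μ),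
        p.1 ∈ Set.uIoc (0 : ℝ) 1 :=
      Measure.quasiMeasurePreserving_fst.ae (ae_restrict_mem measurableSet_uIoc)
    filter_upwards [hset] with p hp
    rw [Set.uIoc_of_le zero_le_one] at hp
    simp only [Function.uncurry, norm_mul, Real.norm_eq_abs]
    have h1 : |1 - p.1| ≤ 1 := abs_le.2 ⟨by linarith [hp.2], by linarith [hp.1]⟩
    exact mul_le_one₀ h1 (abs_nonneg _) (Real.abs_cos_le_one _)
  have hcos : ∀ t : ℝ, ∫ y, Real.cos (t * y) ∂μ ≤ ‖charFun μ t‖ := by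
    intro t
    have hre : ∫ y, Real.cos (t * y) ∂μ = (charFun μ t).re := by
      rw [charFun_apply_real]
      have hint : Integrable (fun x : ℝ => Complex.exp (t * x * Complex.I)) μ := by
        refine Integrable.of_bound (C := 1) (by fun_prop) (ae_of_all _ fun x => ?_)
        rw [← Complex.ofReal_mul, Complex.norm_exp_ofReal_mul_I]
      have h := integral_re hint
      simp only [RCLike.re_eq_complex_re] at h
      rw [← h]
      refine integral_congr_ae (ae_of_all _ fun x => ?_)
      simp only [← Complex.ofReal_mul, Complex.exp_ofReal_mul_I_re]
    exact hre.trans_le (Complex.re_le_norm _)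
  have hfub := intervalIntegral_integral_swap hintegrable
  have hupper : ∫ t in (0 : ℝ)..1, ∫ y, (1 - t) * Real.cos (t * y) ∂μ
      ≤ ∫ t in (0 : ℝ)..1, ‖charFun μ t‖ := by
    refine intervalIntegral.integral_mono_on zero_le_one ?_ intervalIntegrable_charFun.norm ?_
    · rw [intervalIntegrable_iff]
      exact hintegrable.integral_prod_left
    · intro t ht
      rw [integral_const_mul]
      calc (1 - t) * ∫ y, Real.cos (t * y) ∂μ ≤ (1 - t) * ‖charFun μ t‖ :=
            mul_le_mul_of_nonneg_left (hcos t) (by linarith [ht.2])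
        _ ≤ ‖charFun μ t‖ := by nlinarith [norm_nonneg (charFun μ t), ht.1]
  have hlower : μ.real {y | |y| ≤ 1} * (1 / 5)
      ≤ ∫ y, (∫ t in (0 : ℝ)..1, (1 - t) * Real.cos (t * y)) ∂μ := by
    rw [← smul_eq_mul, ← integral_indicator_const _ hmeas]
    refine integral_mono_of_nonneg (f := {y : ℝ | |y| ≤ 1}.indicator fun _ => (1 / 5 : ℝ))
      (ae_of_all _ fun y => ?_) ?_ (ae_of_all _ fun y => ?_)
    · exact Set.indicator_nonneg (fun _ _ => by norm_num) y
    · have h := hintegrable.integral_prod_right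
      refine h.congr (ae_of_all _ fun y => ?_)
      simp [intervalIntegral.integral_of_le, Set.uIoc_of_le, Function.uncurry]
    · by_cases hy : |y| ≤ 1
      · simpa [Set.indicator, hy] using one_fifth_le_integral_one_sub_mul_cos hy
      · simpa [Set.indicator, hy] using integral_one_sub_mul_cos_nonneg y
  linarith

/-! ### Decay of the characteristic function near the origin -/

/-- Symmetry makes the characteristic function real. If its modulus were always 1, it would be
continuous with values ±1 and equal to 1 at 0, hence constant, and the law would be the point mass
at 0. -/
lemma exists_pos_norm_charFun_lt_one {ν : Measure ℝ} [IsProbabilityMeasure ν]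
    (hsymm : IsSymmetricLaw ν) (hdirac : ∀ x : ℝ, ν ≠ Measure.dirac x) :
    ∃ t : ℝ, 0 < t ∧ ‖charFun ν t‖ < 1 := by
  by_contra! hcon
  have hnorm : ∀ t, ‖charFun ν t‖ = 1 := by
    intro t
    refine le_antisymm (norm_charFun_le_one t) ?_
    rcases lt_trichotomy t 0 with ht | rfl | ht
    · have h := hcon (-t) (by linarith)
      rwa [charFun_neg, Complex.norm_conj] at h
    · simp [charFun_zero]
    · exact hcon t ht
  have hreal : ∀ t, ((charFun ν t).re : ℂ) = charFun ν t := by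
    intro t
    have h : charFun ν t = charFun ν (-t) := by
      have hmap := charFun_map_mul (μ := ν) (-1) t
      have hneg : ν.map (fun x => -1 * x) = ν := by
        simpa only [IsSymmetricLaw, neg_one_mul] using hsymm
      rwa [hneg, neg_one_mul] at hmap
    rw [charFun_neg] at h
    exact (Complex.conj_eq_iff_re.1 h.symm)
  have hsq : ∀ t, (charFun ν t).re ^ 2 = 1 := by
    intro t
    have h := hnorm t
    rw [← hreal t, Complex.norm_real, Real.norm_eq_abs] at h
    rw [← sq_abs, h, one_pow]
  have hcont : Continuous fun t => (charFun ν t).re :=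
    Complex.continuous_re.comp continuous_charFun
  have hone : ∀ t, (charFun ν t).re = 1 := by
    rcases isPreconnected_univ.eq_or_eq_neg_of_sq_eq (f := fun t => (charFun ν t).re)
      (g := fun _ => (1 : ℝ)) hcont.continuousOn continuousOn_const
      (fun t _ => by simpa using hsq t) (fun _ => one_ne_zero) with h | h
    · exact fun t => h (Set.mem_univ t)
    · have h0 := h (Set.mem_univ (0 : ℝ))
      simp [charFun_zero] at h0
      norm_num at h0
  refine hdirac 0 (Measure.ext_of_charFun ?_)
  ext t
  rw [← hreal t, hone t]
  simp

/-- The moving argument is absorbed by Slutsky's theorem: t_i Z_i converges in distribution to t₀ Y,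
and the characteristic functions are then compared at 1. -/
lemma MeasureTheory.TendstoInDistribution.tendsto_charFun {ι Ω Ω' : Type*} [MeasurableSpace Ω]
    [MeasurableSpace Ω'] {P : Measure Ω} [IsProbabilityMeasure P] {Q : Measure Ω'}
    [IsProbabilityMeasure Q] {Z : ι → Ω → ℝ} {Y : Ω' → ℝ} {l : Filter ι} [l.IsCountablyGenerated]
    (h : TendstoInDistribution Z l Y (fun _ => P) Q) {t : ι → ℝ} {t₀ : ℝ}
    (ht : Tendsto t l (𝓝 t₀)) :
    Tendsto (fun i => charFun (P.map (Z i)) (t i)) l (𝓝 (charFun (Q.map Y) t₀)) := by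
  have hconst : TendstoInMeasure P (fun i (_ : Ω) => t i) l (fun _ => t₀) := by
    rw [tendstoInMeasure_iff_norm]
    intro ε hε
    refine tendsto_const_nhds.congr' ?_
    filter_upwards [ht.eventually (Metric.ball_mem_nhds t₀ hε)] with i hi
    rw [dist_eq_norm] at hi
    simp only [not_le.2 hi, Set.ofPred_false, measure_empty]
  have hprod := h.continuous_comp_prodMk_of_tendstoInMeasure_const
    (g := fun p : ℝ × ℝ => p.2 * p.1) (by fun_prop) hconst fun _ => aemeasurable_const
  have hlim := (ProbabilityMeasure.tendsto_iff_forall_integral_rclike_tendsto ℂ).1 hprod.tendsto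
    (BoundedContinuousFunction.innerProbChar (1 : ℝ))
  simp only [ProbabilityMeasure.coe_mk] at hlim
  simp only [← charFun_eq_integral_innerProbChar] at hlim
  rw [charFun_map_mul_comp h.aemeasurable_limit, mul_one] at hlim
  refine hlim.congr fun i => ?_
  rw [charFun_map_mul_comp (h.forall_aemeasurable i), mul_one]

lemma charFun_map_sum_mul {Ω : Type*} [MeasurableSpace Ω] {P : Measure Ω} {X : ℕ → Ω → ℝ}
    (hmeas : ∀ i, Measurable (X i)) (hindep : iIndepFun X P)
    (hident : ∀ i, IdentDistrib (X i) (X 0) P P) (w : ℕ → ℝ) (n : ℕ) (t : ℝ) :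
    charFun (P.map fun ω => ∑ i ∈ Finset.range n, w i * X i ω) t =
      ∏ i ∈ Finset.range n, charFun (P.map (X 0)) (w i * t) := by
  have hw : iIndepFun (fun i ω => w i * X i ω) P :=
    hindep.comp (fun i x => w i * x) fun i => measurable_const_mul (w i)
  rw [(hw.restrict _).charFun_map_fun_finsetSum_eq_prod
    fun i _ => ((hmeas i).const_mul (w i)).aemeasurable, Finset.prod_apply]
  refine Finset.prod_congr rfl fun i _ => ?_
  rw [charFun_map_mul_comp (hmeas i).aemeasurable, (hident i).map_eq]

/-- Passing to the modulus removes the uncontrolled centring constants. -/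
lemma norm_charFun_map_walk_div_sub {Ω : Type*} [MeasurableSpace Ω] {P : Measure Ω}
    {X : ℕ → Ω → ℝ} (hmeas : ∀ i, Measurable (X i)) (hindep : iIndepFun X P)
    (hident : ∀ i, IdentDistrib (X i) (X 0) P P) (n : ℕ) (d A t : ℝ) :
    ‖charFun (P.map fun ω => walk X n ω / d - A) t‖ = ‖charFun (P.map (X 0)) (t / d)‖ ^ n := by
  have hsum : (fun ω => walk X n ω / d - A)
      = (fun x => x + -A) ∘ fun ω => ∑ i ∈ Finset.range n, d⁻¹ * X i ω := by
    funext ω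
    simp only [walk, Function.comp, ← Finset.mul_sum]
    ring
  rw [hsum, ← Measure.map_map (by fun_prop) (by fun_prop), charFun_map_add_const,
    charFun_map_sum_mul hmeas hindep hident (fun _ => d⁻¹)]
  simp only [Finset.prod_const, Finset.card_range, norm_mul, norm_pow]
  rw [Complex.norm_exp_ofReal_mul_I, mul_one, div_eq_inv_mul]

/-- Domain of normal attraction gives stretched exponential decay of the characteristic function
of the increments near the origin. -/
lemma exists_norm_charFun_le_exp_neg_rpow {Ω : Type*} [MeasurableSpace Ω] {P : Measure Ω}
    [IsProbabilityMeasure P] {X : ℕ → Ω → ℝ} (hmeas : ∀ i, Measurable (X i))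
    (hindep : iIndepFun X P) (hident : ∀ i, IdentDistrib (X i) (X 0) P P)
    {α : ℝ} (hα : 0 < α) {ν : Measure ℝ} [IsProbabilityMeasure ν]
    (hattr : InDomainOfNormalAttraction P X α ν)
    {t₀ : ℝ} (ht₀ : 0 < t₀) (hν : ‖charFun ν t₀‖ < 1) :
    ∃ c > 0, ∃ δ > 0, ∀ s : ℝ, 0 < s → s ≤ δ →
      ‖charFun (P.map (X 0)) s‖ ≤ Real.exp (-c * s ^ α) := by
  obtain ⟨a, ha, A, hconv⟩ := hattr
  -- `x s` solves s · a · x^(1/α) = t₀: after about `x s` steps, frequency `s` for the increments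
  -- becomes `t₀` for the normalised walk.
  let x : ℝ → ℝ := fun s => (t₀ / (a * s)) ^ α
  let N : ℝ → ℕ := fun s => ⌈x s⌉₊
  have hx : Tendsto x (𝓝[>] 0) atTop := by
    refine (tendsto_rpow_atTop hα).comp ?_
    have h : Tendsto (fun s : ℝ => t₀ / a * s⁻¹) (𝓝[>] 0) atTop :=
      tendsto_inv_nhdsGT_zero.const_mul_atTop (div_pos ht₀ ha)
    refine h.congr fun s => ?_
    rw [← div_eq_mul_inv, div_div]
  have hN : Tendsto N (𝓝[>] 0) atTop := tendsto_nat_ceil_atTop.comp hx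
  have hratio : Tendsto (fun s => t₀ * ((N s : ℝ) / x s) ^ (1 / α)) (𝓝[>] 0) (𝓝 t₀) := by
    have h := ((tendsto_nat_ceil_div_atTop (R := ℝ)).comp hx).rpow_const
      (p := 1 / α) (Or.inl one_ne_zero)
    simpa using h.const_mul t₀
  have harg : Tendsto (fun s : ℝ => s * (a * (N s : ℝ) ^ (1 / α))) (𝓝[>] 0) (𝓝 t₀) := by
    refine hratio.congr' ?_
    filter_upwards [self_mem_nhdsWithin] with s hs
    have hs : 0 < s := hs
    have hbase : 0 < t₀ / (a * s) := by positivity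
    rw [Real.div_rpow (Nat.cast_nonneg _) (Real.rpow_nonneg hbase.le _), ← Real.rpow_mul hbase.le,
      mul_one_div_cancel hα.ne', Real.rpow_one]
    field_simp
  have hsub : TendstoInDistribution
      (fun s ω => walk X (N s) ω / (a * (N s : ℝ) ^ (1 / α)) - A (N s))
      (𝓝[>] (0 : ℝ)) (fun y : ℝ => y) (fun _ => P) ν :=
    ⟨fun s => hconv.forall_aemeasurable (N s), hconv.aemeasurable_limit, hconv.tendsto.comp hN⟩
  have hlim := (hsub.tendsto_charFun harg).norm
  simp only [norm_charFun_map_walk_div_sub hmeas hindep hident, Measure.map_id'] at hlim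
  -- For small `s` this yields |φ(s)|^N < r < 1, with N = `N s` of order s^(-α).
  obtain ⟨r, hr1, hr2⟩ := exists_between hν
  have hr0 : 0 < r := (norm_nonneg _).trans_lt hr1
  have hk : 0 < -Real.log r := by linarith [Real.log_neg hr0 hr2]
  have hevent : ∀ᶠ s in 𝓝[>] (0 : ℝ), ‖charFun (P.map (X 0)) s‖
      ≤ Real.exp (-(-Real.log r / (2 * (t₀ / a) ^ α)) * s ^ α) := by
    filter_upwards [hlim.eventually_lt_const hr1, hx.eventually_ge_atTop 1,
      self_mem_nhdsWithin] with s hs1 hs2 hs3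
    have hs3 : 0 < s := hs3
    have hNpos : 0 < (N s : ℝ) := by
      have := Nat.le_ceil (x s)
      linarith
    have hN2 : (N s : ℝ) ≤ 2 * x s := by
      have := (Nat.ceil_lt_add_one (zero_le_one.trans hs2)).le
      linarith
    rw [mul_div_assoc, div_self (by positivity), mul_one] at hs1
    have hxs : x s = (t₀ / a) ^ α / s ^ α := by
      simp only [x]
      rw [← div_div, Real.div_rpow (by positivity) hs3.le]
    -- Since N ≤ 2x, which is the source of the 2 in the constant, the N-th power of the claimed
    -- bound is at least `r`.
    by_contra! hlt
    have hpow := pow_lt_pow_left₀ hlt (Real.exp_pos _).le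
      (n := N s) (by exact_mod_cast hNpos.ne')
    rw [← Real.exp_nat_mul] at hpow
    have hle : r ≤ Real.exp ((N s : ℝ) *
        (-(-Real.log r / (2 * (t₀ / a) ^ α)) * s ^ α)) := by
      rw [← Real.log_le_iff_le_exp hr0]
      have hfac : (N s : ℝ) * (-(-Real.log r / (2 * (t₀ / a) ^ α)) * s ^ α)
          = -(-Real.log r * ((N s : ℝ) / (2 * x s))) := by
        rw [hxs]
        field_simp
      have hq : (N s : ℝ) / (2 * x s) ≤ 1 := div_le_one_of_le₀ hN2 (by linarith)
      rw [hfac]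
      nlinarith
    linarith
  rw [(nhdsGT_basis (0 : ℝ)).eventually_iff] at hevent
  obtain ⟨δ, hδ, hδle⟩ := hevent
  exact ⟨_, by positivity, δ / 2, by positivity, fun s hs hsδ => hδle ⟨hs, by linarith⟩⟩

/-! ### The centre of mass as a weighted sum -/

/-- `X i` enters exactly the n - i sums S_{i+1}, …, S_n. -/
lemma sum_walk_eq_sum_mul {Ω : Type*} (X : ℕ → Ω → ℝ) (n : ℕ) (ω : Ω) :
    ∑ i ∈ Finset.Icc 1 n, walk X i ω = ∑ i ∈ Finset.range n, ((n : ℝ) - i) * X i ω := by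
  induction n with
  | zero => simp
  | succ n ih =>
    rw [Finset.sum_Icc_succ_top (by omega), ih, walk, Finset.sum_range_succ _ n,
      Finset.sum_range_succ _ n, ← add_assoc, ← Finset.sum_add_distrib]
    push_cast
    congr 1
    · exact Finset.sum_congr rfl fun i _ => by ring
    · ring

lemma centreOfMass_eq_sum {Ω : Type*} (X : ℕ → Ω → ℝ) (n : ℕ) (ω : Ω) :
    centreOfMass X n ω = ∑ i ∈ Finset.range n, ((n : ℝ) - i) / n * X i ω := by
  rw [centreOfMass, sum_walk_eq_sum_mul, Finset.mul_sum]
  exact Finset.sum_congr rfl fun i _ => by ring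

lemma measurable_centreOfMass {Ω : Type*} [MeasurableSpace Ω] {X : ℕ → Ω → ℝ}
    (hX : ∀ i, Measurable (X i)) (n : ℕ) : Measurable (centreOfMass X n) := by
  have h : centreOfMass X n = fun ω => ∑ i ∈ Finset.range n, ((n : ℝ) - i) / n * X i ω :=
    funext (centreOfMass_eq_sum X n)
  rw [h]
  fun_prop

lemma centreOfMass_neg {Ω : Type*} (X : ℕ → Ω → ℝ) (n : ℕ) (ω : Ω) :
    centreOfMass (fun i ω => -X i ω) n ω = -centreOfMass X n ω := by
  simp [centreOfMass_eq_sum]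

/-- Changing finitely many increments moves the centre of mass by a bounded amount. -/
lemma centreOfMass_le_add {Ω : Type*} {X Y : ℕ → Ω → ℝ} {ω : Ω} {N : ℕ}
    (hXY : ∀ i, N ≤ i → X i ω = Y i ω) (n : ℕ) :
    centreOfMass X n ω ≤ centreOfMass Y n ω + ∑ i ∈ Finset.range N, |X i ω - Y i ω| := by
  rw [← sub_le_iff_le_add', centreOfMass_eq_sum, centreOfMass_eq_sum, ← Finset.sum_sub_distrib]
  calc ∑ i ∈ Finset.range n, (((n : ℝ) - i) / n * X i ω - ((n : ℝ) - i) / n * Y i ω)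
      ≤ ∑ i ∈ Finset.range n, |X i ω - Y i ω| := by
        refine Finset.sum_le_sum fun i hi => ?_
        have hin : (i : ℝ) ≤ n := by exact_mod_cast (Finset.mem_range.1 hi).le
        have hw0 : 0 ≤ ((n : ℝ) - i) / n := div_nonneg (by linarith) (Nat.cast_nonneg n)
        have hw1 : ((n : ℝ) - i) / n ≤ 1 :=
          div_le_one_of_le₀ (by linarith [Nat.cast_nonneg (α := ℝ) i]) (Nat.cast_nonneg n)
        rw [← mul_sub]
        exact (mul_le_mul_of_nonneg_left (le_abs_self _) hw0).trans
          (mul_le_of_le_one_left (abs_nonneg _) hw1)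
    _ ≤ ∑ i ∈ Finset.range N, |X i ω - Y i ω| := by
        rw [← Finset.sum_filter_add_sum_filter_not (Finset.range n) (· < N)]
        rw [Finset.sum_eq_zero (s := (Finset.range n).filter (¬ · < N)), add_zero]
        · refine Finset.sum_le_sum_of_subset_of_nonneg (fun i hi => ?_)
            fun _ _ _ => abs_nonneg _
          exact Finset.mem_range.2 (Finset.mem_filter.1 hi).2
        · intro i hi
          rw [hXY i (not_lt.1 (Finset.mem_filter.1 hi).2), sub_self, abs_zero]

/-! ### Zero-one law and oscillation -/

/-- The sequences of increments whose centre of mass is unbounded above along the tail. -/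
def unboundedAboveSeqs : Set (ℕ → ℝ) :=
  {x | ∀ M : ℕ, ∃ᶠ n in atTop, (M : ℝ) ≤ centreOfMass (fun i y => y i) n x}

lemma measurableSet_unboundedAboveSeqs : MeasurableSet unboundedAboveSeqs := by
  have hG := measurable_centreOfMass (X := fun i (y : ℕ → ℝ) => y i) fun i => measurable_pi_apply i
  simp only [unboundedAboveSeqs, frequently_atTop, Set.ofPred_forall, Set.ofPred_exists]
  refine .iInter fun M => .iInter fun N => .iUnion fun n => ?_
  exact (MeasurableSet.const _).inter (measurableSet_le measurable_const (hG n))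

lemma mem_unboundedAboveSeqs_of_eventuallyEq {x y : ℕ → ℝ} {N : ℕ}
    (hxy : ∀ i, N ≤ i → x i = y i) (hx : x ∈ unboundedAboveSeqs) : y ∈ unboundedAboveSeqs := by
  intro M
  obtain ⟨K, hK⟩ := exists_nat_ge (M + ∑ i ∈ Finset.range N, |x i - y i|)
  refine (hx K).mono fun n hn => ?_
  have h := centreOfMass_le_add (X := fun i (_ : Unit) => x i) (Y := fun i _ => y i)
    (ω := ()) hxy n
  change _ ≤ centreOfMass (fun i (_ : Unit) => y i) n ()
  change _ ≤ centreOfMass (fun i (_ : Unit) => x i) n () at hn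
  linarith

/-- **Kolmogorov's zero-one law** for sets of sequences invariant under finite modifications. -/
lemma measure_preimage_zero_or_one_of_tail {Ω : Type*} [MeasurableSpace Ω] {P : Measure Ω}
    {X : ℕ → Ω → ℝ} (hmeas : ∀ i, Measurable (X i))
    (hindep : iIndepFun X P) {U : Set (ℕ → ℝ)} (hU : MeasurableSet U)
    (htail : ∀ (x y : ℕ → ℝ) (N : ℕ), (∀ i, N ≤ i → x i = y i) → x ∈ U → y ∈ U) :
    P {ω | (fun i => X i ω) ∈ U} = 0 ∨ P {ω | (fun i => X i ω) ∈ U} = 1 := by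
  refine measure_zero_or_one_of_measurableSet_limsup_atTop
    (s := fun i => MeasurableSpace.comap (X i) inferInstance)
    (fun n => (hmeas n).comap_le) hindep.iIndep ?_
  rw [limsup_eq_iInf_iSup_of_nat, MeasurableSpace.measurableSet_iInf]
  intro N
  -- Zeroing the first `N` coordinates does not affect membership in `U`, and the truncated sequence
  -- depends only on the increments from index `N` on.
  have htrunc : Measurable[⨆ i, ⨆ (_ : i ≥ N), MeasurableSpace.comap (X i) inferInstance]
      (fun ω i => if N ≤ i then X i ω else 0) := by
    refine @measurable_pi_lambda _ _ _ (_) _ _ fun i => ?_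
    by_cases hi : N ≤ i
    · simp only [hi, if_true]
      exact (comap_measurable (X i)).mono
        (le_iSup₂_of_le (f := fun i (_ : i ≥ N) => MeasurableSpace.comap (X i) inferInstance)
          i hi le_rfl) le_rfl
    · simp only [hi, if_false]
      exact measurable_const
  convert htrunc hU using 1
  ext ω
  exact ⟨htail _ _ N fun i hi => by simp [hi], htail _ _ N fun i hi => by simp [hi]⟩

/-- A sequence of independent symmetric variables has the same law as its negative. -/
lemma measure_neg_mem_eq_of_symmetric {Ω : Type*} [MeasurableSpace Ω] {P : Measure Ω}
    [IsProbabilityMeasure P] {X : ℕ → Ω → ℝ} (hmeas : ∀ i, Measurable (X i))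
    (hindep : iIndepFun X P) (hsymm : ∀ i, IsSymmetricLaw (P.map (X i)))
    {U : Set (ℕ → ℝ)} (hU : MeasurableSet U) :
    P {ω | (fun i => -X i ω) ∈ U} = P {ω | (fun i => X i ω) ∈ U} := by
  have hneg : iIndepFun (fun i ω => -X i ω) P :=
    hindep.comp (fun _ x => -x) fun _ => measurable_neg
  have hlaw : P.map (fun ω i => -X i ω) = P.map (fun ω i => X i ω) := by
    have hinf := (iIndepFun_iff_map_fun_eq_infinitePi_map
      (X := fun i ω => -X i ω) fun i => (hmeas i).neg).1 hneg
    rw [hinf, (iIndepFun_iff_map_fun_eq_infinitePi_map hmeas).1 hindep]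
    congr 1
    funext i
    conv_rhs => rw [← hsymm i, Measure.map_map measurable_neg (hmeas i)]
    rfl
  have h := congrArg (fun μ => μ U) hlaw
  rwa [Measure.map_apply (by fun_prop) hU, Measure.map_apply (by fun_prop) hU] at h

lemma limsup_eq_top_of_frequently_nat_le {u : ℕ → ℝ} (hu : ∀ M : ℕ, ∃ᶠ n in atTop, (M : ℝ) ≤ u n) :
    limsup (fun n => (u n : EReal)) atTop = ⊤ := by
  rw [EReal.eq_top_iff_forall_lt]
  intro y
  obtain ⟨M, hM⟩ := exists_nat_gt y
  refine (EReal.coe_lt_coe_iff.2 hM).trans_le (le_limsup_of_frequently_le ?_)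
  exact (hu M).mono fun n hn => EReal.coe_le_coe_iff.2 hn

lemma liminf_eq_bot_of_frequently_nat_le_neg {u : ℕ → ℝ}
    (hu : ∀ M : ℕ, ∃ᶠ n in atTop, (M : ℝ) ≤ -u n) :
    liminf (fun n => (u n : EReal)) atTop = ⊥ := by
  rw [EReal.eq_bot_iff_forall_lt]
  intro y
  obtain ⟨M, hM⟩ := exists_nat_gt (-y)
  refine lt_of_le_of_lt (b := (((-M : ℝ)) : EReal)) (liminf_le_of_frequently_le ?_)
    (EReal.coe_lt_coe_iff.2 (by linarith))
  exact (hu M).mono fun n hn => EReal.coe_le_coe_iff.2 (by linarith)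

/-- For symmetric increments, transience of the centre of mass forces oscillation. -/
lemma ae_unbounded_of_ae_tendsto_abs {Ω : Type*} [MeasurableSpace Ω] {P : Measure Ω}
    [IsProbabilityMeasure P] {X : ℕ → Ω → ℝ} (hmeas : ∀ i, Measurable (X i))
    (hindep : iIndepFun X P) (hsymm : ∀ i, IsSymmetricLaw (P.map (X i)))
    (habs : ∀ᵐ ω ∂P, Tendsto (fun n => |centreOfMass X n ω|) atTop atTop) :
    ∀ᵐ ω ∂P, (∀ M : ℕ, ∃ᶠ n in atTop, (M : ℝ) ≤ centreOfMass X n ω) ∧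
      ∀ M : ℕ, ∃ᶠ n in atTop, (M : ℝ) ≤ -centreOfMass X n ω := by
  have hU := measurableSet_unboundedAboveSeqs
  have hup : ∀ ω, (fun i => X i ω) ∈ unboundedAboveSeqs ↔
      ∀ M : ℕ, ∃ᶠ n in atTop, (M : ℝ) ≤ centreOfMass X n ω := fun ω => Iff.rfl
  have hdown : ∀ ω, (fun i => -X i ω) ∈ unboundedAboveSeqs ↔
      ∀ M : ℕ, ∃ᶠ n in atTop, (M : ℝ) ≤ -centreOfMass X n ω := fun ω => by
    simp only [← centreOfMass_neg]
    exact Iff.rfl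
  have hsame := measure_neg_mem_eq_of_symmetric hmeas hindep hsymm hU
  have hor : ∀ᵐ ω ∂P, (fun i => X i ω) ∈ unboundedAboveSeqs ∨
      (fun i => -X i ω) ∈ unboundedAboveSeqs := by
    filter_upwards [habs] with ω hω
    rw [hup, hdown]
    by_contra! hcon
    obtain ⟨⟨M, hM⟩, M', hM'⟩ := hcon
    have hlarge := hω.eventually_ge_atTop (max (M : ℝ) M')
    obtain ⟨n, h1, h2, h3⟩ :=
      (hM.and (hM'.and hlarge)).exists
    rcases le_abs.1 h3 with h | h
    · exact h1.not_ge ((le_max_left _ _).trans h)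
    · exact h2.not_ge ((le_max_right _ _).trans h)
  have hmeasX : Measurable fun ω i => X i ω := measurable_pi_lambda _ hmeas
  have hmeasN : Measurable fun ω i => -X i ω := measurable_pi_lambda _ fun i => (hmeas i).neg
  -- If the probability were 0, symmetry would make both events null, although their union is almost
  -- sure.
  have hone : P {ω | (fun i => X i ω) ∈ unboundedAboveSeqs} = 1 := by
    refine (measure_preimage_zero_or_one_of_tail hmeas hindep hU
      fun _ _ _ => mem_unboundedAboveSeqs_of_eventuallyEq).resolve_left fun h0 => ?_
    rw [h0] at hsame
    have hfalse : ∀ᵐ ω ∂P, False := by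
      filter_upwards [hor, measure_eq_zero_iff_ae_notMem.1 h0,
        measure_eq_zero_iff_ae_notMem.1 hsame] with ω h h1 h2
      exact h.elim h1 h2
    exact hfalse.exists.elim fun _ => id
  rw [hone] at hsame
  filter_upwards [(mem_ae_iff_prob_eq_one (hmeasX hU)).2 hone,
    (mem_ae_iff_prob_eq_one (hmeasN hU)).2 hsame] with ω h1 h2
  exact ⟨(hup ω).1 h1, (hdown ω).1 h2⟩

/-! ### Borel–Cantelli and transience -/

lemma half_le_sum_weights {n : ℕ} (hn : 0 < n) :
    (n : ℝ) / 2 ≤ ∑ i ∈ Finset.range n, ((n : ℝ) - i) / n := by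
  have hid : ∀ m : ℕ, ∑ i ∈ Finset.range m, (i : ℝ) = m * (m - 1) / 2 := by
    intro m
    induction m with
    | zero => simp
    | succ m ih =>
      rw [Finset.sum_range_succ, ih]
      push_cast
      ring
  have hn' : (0 : ℝ) < n := by exact_mod_cast hn
  rw [← Finset.sum_div, Finset.sum_sub_distrib, hid, Finset.sum_const, Finset.card_range,
    nsmul_eq_mul, le_div_iff₀ hn']
  nlinarith

lemma measureReal_abs_le_inv_le {Ω : Type*} [MeasurableSpace Ω] {P : Measure Ω}
    [IsProbabilityMeasure P] {Y : Ω → ℝ} (hY : Measurable Y) {δ : ℝ} (hδ : 0 < δ) :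
    P.real {ω | |Y ω| ≤ δ⁻¹} ≤ 5 * ∫ t in (0 : ℝ)..1, ‖charFun (P.map Y) (δ * t)‖ := by
  have hmap : IsProbabilityMeasure (P.map fun ω => δ * Y ω) :=
    Measure.isProbabilityMeasure_map (hY.const_mul δ).aemeasurable
  have h := measureReal_abs_le_one_le_integral_norm_charFun (P.map fun ω => δ * Y ω)
  simp only [charFun_map_mul_comp hY.aemeasurable] at h
  rw [map_measureReal_apply (hY.const_mul δ)
    (measurableSet_le (by fun_prop) (by fun_prop))] at h
  refine le_of_eq_of_le ?_ h
  congr 1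
  ext ω
  simp only [Set.mem_ofPred_eq, Set.mem_preimage, abs_mul, abs_of_pos hδ]
  rw [← one_div, le_div_iff₀' hδ]

/-- If the characteristic function of the increments decays like `exp (-c |s| ^ α)` near the
origin, the centre of mass charges bounded sets with probability `O(n ^ (-1 / α))`. -/
lemma exists_measureReal_abs_centreOfMass_le {Ω : Type*} [MeasurableSpace Ω] {P : Measure Ω}
    [IsProbabilityMeasure P] {X : ℕ → Ω → ℝ} (hmeas : ∀ i, Measurable (X i))
    (hindep : iIndepFun X P) (hident : ∀ i, IdentDistrib (X i) (X 0) P P)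
    {α c δ : ℝ} (hα0 : 0 < α) (hα1 : α ≤ 1) (hc : 0 < c) (hδ : 0 < δ)
    (hdecay : ∀ s : ℝ, 0 < s → s ≤ δ → ‖charFun (P.map (X 0)) s‖ ≤ Real.exp (-c * s ^ α)) :
    ∃ C : ℝ, ∀ n : ℕ, 0 < n →
      P.real {ω | |centreOfMass X n ω| ≤ δ⁻¹} ≤ C * (n : ℝ) ^ (-1 / α) := by
  -- The 5 is from the small ball inequality; the rest is from ∫₀^∞ exp(-B t^α) dt = B^(-1/α) Γ(1/α
  -- + 1) with B = c δ^α n / 2.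
  refine ⟨5 * ((c * δ ^ α / 2) ^ (-1 / α) * Real.Gamma (1 / α + 1)), fun n hn => ?_⟩
  have hn' : (0 : ℝ) < n := by exact_mod_cast hn
  have hG := measurable_centreOfMass hmeas n
  have hB : 0 < c * δ ^ α / 2 * n := by positivity
  have hpoint : ∀ t : ℝ, 0 < t → t ≤ 1 → ‖charFun (P.map (centreOfMass X n)) (δ * t)‖
      ≤ Real.exp (-(c * δ ^ α / 2 * n) * t ^ α) := by
    intro t ht0 ht1
    have hsum : centreOfMass X n = fun ω => ∑ i ∈ Finset.range n, ((n : ℝ) - i) / n * X i ω :=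
      funext (centreOfMass_eq_sum X n)
    rw [hsum, charFun_map_sum_mul hmeas hindep hident (fun i => ((n : ℝ) - i) / n), norm_prod]
    have hterm : ∀ i ∈ Finset.range n,
        ‖charFun (P.map (X 0)) (((n : ℝ) - i) / n * (δ * t))‖
          ≤ Real.exp (-(c * (δ * t) ^ α) * (((n : ℝ) - i) / n)) := by
      intro i hi
      have hin : (i : ℝ) < n := by exact_mod_cast Finset.mem_range.1 hi
      have hw0 : 0 < ((n : ℝ) - i) / n := div_pos (by linarith) hn'
      have hw1 : ((n : ℝ) - i) / n ≤ 1 :=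
        div_le_one_of_le₀ (by linarith [Nat.cast_nonneg (α := ℝ) i]) hn'.le
      refine (hdecay _ (by positivity) ?_).trans (Real.exp_le_exp.2 ?_)
      · calc ((n : ℝ) - i) / n * (δ * t) ≤ 1 * (δ * 1) := by gcongr
          _ = δ := by ring
      · rw [Real.mul_rpow hw0.le (by positivity)]
        -- As weights are at most 1 and α ≤ 1, the power can be replaced by the weight itself, whose
        -- sum is explicit.
        have hpow : ((n : ℝ) - i) / n ≤ (((n : ℝ) - i) / n) ^ α := by
          simpa using Real.rpow_le_rpow_of_exponent_ge hw0 hw1 hα1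
        have hpos : 0 ≤ c * (δ * t) ^ α := by positivity
        nlinarith [mul_le_mul_of_nonneg_left hpow hpos]
    refine (Finset.prod_le_prod (fun _ _ => norm_nonneg _) hterm).trans ?_
    rw [← Real.exp_sum, ← Finset.mul_sum, Real.exp_le_exp, Real.mul_rpow hδ.le ht0.le]
    have hpos : 0 ≤ c * (δ ^ α * t ^ α) := by positivity
    nlinarith [mul_le_mul_of_nonneg_left (half_le_sum_weights hn) hpos]
  have hint : IntegrableOn (fun t : ℝ => Real.exp (-(c * δ ^ α / 2 * n) * t ^ α)) (Set.Ioi 0) := by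
    simpa using integrableOn_rpow_mul_exp_neg_mul_rpow (s := 0) (by norm_num) hα0 hB
  have hcharInt : IntervalIntegrable
      (fun t => ‖charFun (P.map (centreOfMass X n)) (δ * t)‖) volume 0 1 := by
    have : IsProbabilityMeasure (P.map (centreOfMass X n)) :=
      Measure.isProbabilityMeasure_map hG.aemeasurable
    have hcont : Continuous (charFun (P.map (centreOfMass X n))) := continuous_charFun
    exact (hcont.comp (continuous_const_mul δ)).norm.intervalIntegrable _ _
  calc P.real {ω | |centreOfMass X n ω| ≤ δ⁻¹}
      ≤ 5 * ∫ t in (0 : ℝ)..1, ‖charFun (P.map (centreOfMass X n)) (δ * t)‖ :=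
        measureReal_abs_le_inv_le hG hδ
    _ ≤ 5 * ∫ t in Set.Ioi (0 : ℝ), Real.exp (-(c * δ ^ α / 2 * n) * t ^ α) := by
        gcongr
        rw [intervalIntegral.integral_of_le zero_le_one]
        calc _ ≤ ∫ t in Set.Ioc (0 : ℝ) 1, Real.exp (-(c * δ ^ α / 2 * n) * t ^ α) :=
              setIntegral_mono_on hcharInt.1 (hint.mono_set Set.Ioc_subset_Ioi_self)
                measurableSet_Ioc fun t ht => hpoint t ht.1 ht.2
          _ ≤ _ := setIntegral_mono_set hint (ae_of_all _ fun _ => (Real.exp_pos _).le)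
                Set.Ioc_subset_Ioi_self.eventuallyLE
    _ = _ := by
        rw [integral_exp_neg_mul_rpow hα0 hB, Real.mul_rpow (by positivity) hn'.le]
        ring

lemma ae_tendsto_abs_centreOfMass {Ω : Type*} [MeasurableSpace Ω] {P : Measure Ω}
    [IsProbabilityMeasure P] {X : ℕ → Ω → ℝ} (hmeas : ∀ i, Measurable (X i))
    (hindep : iIndepFun X P) (hident : ∀ i, IdentDistrib (X i) (X 0) P P)
    {α c δ : ℝ} (hα0 : 0 < α) (hα1 : α < 1) (hc : 0 < c) (hδ : 0 < δ)
    (hdecay : ∀ s : ℝ, 0 < s → s ≤ δ → ‖charFun (P.map (X 0)) s‖ ≤ Real.exp (-c * s ^ α)) :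
    ∀ᵐ ω ∂P, Tendsto (fun n => |centreOfMass X n ω|) atTop atTop := by
  have hfin : ∀ M : ℕ, ∀ᵐ ω ∂P, ∀ᶠ n in atTop, (M : ℝ) ≤ |centreOfMass X n ω| := by
    intro M
    -- The decay persists on a shorter interval, so shrinking `δ` to `η` widens the ball to radius
    -- η⁻¹ ≥ M.
    let η : ℝ := min δ ((M : ℝ) + 1)⁻¹
    have hη : 0 < η := lt_min hδ (by positivity)
    have hMη : (M : ℝ) ≤ η⁻¹ := by
      have h : η ≤ ((M : ℝ) + 1)⁻¹ := min_le_right _ _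
      have := (le_inv_comm₀ hη (by positivity)).1 h
      linarith
    obtain ⟨C, hC⟩ := exists_measureReal_abs_centreOfMass_le hmeas hindep hident hα0 hα1.le hc hη
      fun s hs hsη => hdecay s hs (hsη.trans (min_le_left _ _))
    have hsummable : Summable fun n : ℕ => P.real {ω | |centreOfMass X n ω| ≤ η⁻¹} := by
      have hpow : Summable fun n : ℕ => C * (n : ℝ) ^ (-1 / α) := by
        -- Here α < 1 is decisive: it makes the exponent -1 / α less than -1.
        refine (Real.summable_nat_rpow.2 ?_).mul_left C
        rw [div_lt_iff₀ hα0]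
        linarith
      refine hpow.of_norm_bounded_eventually_nat ?_
      filter_upwards [eventually_gt_atTop 0] with n hn
      rw [Real.norm_of_nonneg measureReal_nonneg]
      exact hC n hn
    have hne : ∑' n, P {ω | |centreOfMass X n ω| ≤ η⁻¹} ≠ ⊤ := by
      have h := hsummable.tsum_ofReal_ne_top
      rwa [tsum_congr fun n => ofReal_measureReal] at h
    filter_upwards [ae_eventually_notMem hne] with ω hω
    filter_upwards [hω] with n hn
    exact hMη.trans (not_le.1 hn).le
  filter_upwards [ae_all_iff.2 hfin] with ω hω
  refine tendsto_atTop.2 fun y => ?_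
  obtain ⟨M, hM⟩ := exists_nat_ge y
  exact (hω M).mono fun n hn => hM.trans hn

theorem theorem1p5 {Ω : Type*} [MeasurableSpace Ω] (P : Measure Ω) [IsProbabilityMeasure P]
    (X : ℕ → Ω → ℝ) (hmeas : ∀ i, Measurable (X i))
    (hindep : iIndepFun X P) (hident : ∀ i, IdentDistrib (X i) (X 0) P P)
    (b h : ℝ) (hlattice : IsLatticeWithMaximalSpan (P.map (X 0)) b h)
    (hsymm : IsSymmetricLaw (P.map (X 0)))
    (α : ℝ) (hα0 : 0 < α) (hα1 : α < 1)
    (ν : Measure ℝ) [IsProbabilityMeasure ν]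
    (hνstable : IsStableLaw α ν) (hνsymm : IsSymmetricLaw ν)
    (hattr : InDomainOfNormalAttraction P X α ν) :
    ∀ᵐ ω ∂P,
      liminf (fun n : ℕ => ((centreOfMass X n ω : ℝ) : EReal)) atTop = ⊥ ∧
      limsup (fun n : ℕ => ((centreOfMass X n ω : ℝ) : EReal)) atTop = ⊤ ∧
      Tendsto (fun n : ℕ => |centreOfMass X n ω|) atTop atTop := by
  obtain ⟨t₀, ht₀, hν⟩ := exists_pos_norm_charFun_lt_one hνsymm hνstable.1
  obtain ⟨c, hc, δ, hδ, hdecay⟩ :=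
    exists_norm_charFun_le_exp_neg_rpow hmeas hindep hident hα0 hattr ht₀ hν
  have habs := ae_tendsto_abs_centreOfMass hmeas hindep hident hα0 hα1 hc hδ hdecay
  have hsymmX : ∀ i, IsSymmetricLaw (P.map (X i)) := fun i => by rwa [(hident i).map_eq]
  filter_upwards [habs, ae_unbounded_of_ae_tendsto_abs hmeas hindep hsymmX habs] with ω h1 h2
  exact ⟨liminf_eq_bot_of_frequently_nat_le_neg h2.2, limsup_eq_top_of_frequently_nat_le h2.1, h1⟩
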